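/- A sign pattern of order $n$ is an $n\times n$ matrix $\mathcal P=[p_{ij}]$ with entries in $\{+,-,0\}$; its qualitative class $\mathcal Q(\mathcal P)$ is the set of all real $n\times n$ matrices $A=[a_{ij}]$ with $\operatorname{sgn}(a_{ij})=p_{ij}$ for all $i,j$. The pattern $\mathcal P$ is consistent if there is an integer $k$ with $0\le k\le n$ such that every $A\in\mathcal Q(\mathcal P)$ has exactly $k$ real eigenvalues, counted with algebraic multiplicity. A submatrix of $\mathcal P$ is a matrix $\mathcal P[\alpha,\beta]$ formed by the rows with index in $\alpha$ and the columns with index in $\beta$, in increasing order. Let $$\mathcal P_4=\begin{bmatrix}0&+&0&0\\+&0&-&0\\0&+&0&+\\0&0&+&0\end{bmatrix},$$ and let ${\mathcal P_4}_-$ denote any $4\times4$ sign pattern $\mathcal N=[n_{ij}]$ with zero diagonal such that $n_{ij}\ne0$ if and only if $n_{ji}\neq 0$, and whose underlying signed undirected graph (with an edge $\{i,j\}$ of sign $n_{ij}n_{ji}$ whenever $n_{ij}\ne0$) is obtained from that of $\mathcal P_4$ by reversing the sign of every edge; thus its edges $\{1,2\},\{2,3\},\{3,4\}$ have signs $-,+,-$.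 Theorem. Let $\mathcal P$ be an irreducible, tridiagonal sign pattern of order $n$ with zero diagonal. If $\mathcal P_4$ or ${\mathcal P_4}_-$ is a submatrix of $\mathcal P$, then $\mathcal P$ is not consistent. -/

import Mathlib

namespace SignPat

/-- An `n × n` sign pattern: a matrix with entries in `{+, -, 0}`, i.e. `{1, -1, 0}`. -/
abbrev SignPattern (n : ℕ) := Matrix (Fin n) (Fin n) SignType

variable {n : ℕ}

/-- The qualitative class of `P`: all real matrices whose entries have the signs given by `P`. -/
def qualClass (P : SignPattern n) : Set (Matrix (Fin n) (Fin n) ℝ) :=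
  {A | ∀ i j, SignType.sign (A i j) = P i j}

/-- The number of real eigenvalues of a real matrix, counted with algebraic multiplicity. -/
noncomputable def numRealEigenvalues (A : Matrix (Fin n) (Fin n) ℝ) : ℕ :=
  Multiset.card A.charpoly.roots

/-- `P` is `k`-consistent: every matrix in its qualitative class has exactly `k` real
eigenvalues (hence exactly `n - k` nonreal ones). -/
def IsKConsistent (P : SignPattern n) (k : ℕ) : Prop :=
  ∀ A ∈ qualClass P, numRealEigenvalues A = k

/-- `P` is consistent: it is `k`-consistent for some `0 ≤ k ≤ n`. -/
def IsConsistent (P : SignPattern n) : Prop :=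
  ∃ k : ℕ, k ≤ n ∧ IsKConsistent P k

/-- `P` is irreducible: there is no splitting of the indices into two nonempty parts `S`, `Sᶜ`
with `P[S, Sᶜ] = 0`, i.e. `P` is not permutation similar to a block triangular pattern. -/
def IsIrreducible (P : SignPattern n) : Prop :=
  ∀ S : Set (Fin n), S.Nonempty → Sᶜ.Nonempty → ∃ i ∈ S, ∃ j ∈ Sᶜ, P i j ≠ 0

/-- Entries off the three central diagonals vanish. -/
def IsTridiagonal (P : SignPattern n) : Prop :=
  ∀ i j : Fin n, (i : ℕ) + 1 < j ∨ (j : ℕ) + 1 < i → P i j = 0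

/-- All diagonal entries vanish. -/
def HasZeroDiagonal (P : SignPattern n) : Prop :=
  ∀ i, P i i = 0

/-- Combinatorially symmetric: `p_ij ≠ 0` if and only if `p_ji ≠ 0`. -/
def IsCombSymm (P : SignPattern n) : Prop :=
  ∀ i j, P i j ≠ 0 ↔ P j i ≠ 0

/-- The underlying signed undirected graph of a combinatorially symmetric pattern, as its signed
adjacency function: `p_ij p_ji`, which is the sign of the edge `{i, j}`, and `0` if there is
no such edge. -/
def edgeSign (P : SignPattern n) (i j : Fin n) : SignType :=
  P i j * P j i

/-- `N` is a pattern `P_-`: a combinatorially symmetric pattern with zero diagonal whose underlying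
signed undirected graph is that of `P` with the sign of every edge reversed. (Such a pattern is not
unique: only the edge signs are prescribed.) -/
def IsEdgeNegation (P N : SignPattern n) : Prop :=
  IsCombSymm N ∧ HasZeroDiagonal N ∧ ∀ i j, edgeSign N i j = -edgeSign P i j

/-- `M` is a submatrix of `P`: `M = P[α, β]` for index sets `α`, `β` of size `m`, with rows and
columns kept in increasing order (`r`, `c` are the increasing enumerations of `α`, `β`). -/
def IsSubmatrix {m : ℕ} (M : SignPattern m) (P : SignPattern n) : Prop :=
  ∃ r c : Fin m → Fin n, StrictMono r ∧ StrictMono c ∧ P.submatrix r c = M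

/-- The pattern `P_4`. -/
def P4 : SignPattern 4 :=
  !![0, 1,  0, 0;
     1, 0, -1, 0;
     0, 1,  0, 1;
     0, 0,  1, 0]

end SignPat

namespace SignPat

open Polynomial Filter Topology

/-! The characteristic polynomial of a tridiagonal matrix with zero diagonal depends only on the
edge weights `b k = a k (k+1) * a (k+1) k`, and equals `X ^ (n % 2)` times a polynomial `pathPoly b
n` in `X ^ 2`. If the latter has simple nonzero real roots, there are `n % 2 + 2 * numPos T` real
eigenvalues, so it suffices to find two choices of weights with the prescribed signs and different
numbers of positive roots.

Either forbidden submatrix forces three consecutive edges whose signs alternate. An isolated path on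
those four vertices gives a quadratic with root sum `b₀ + b₁ + b₂` and product `b₀ * b₂ > 0`; as
`b₁` opposes the other two, both roots can be made positive or both negative. Gluing it to the
preceding vertices by an edge of tiny weight (`IsRealization.extend_four`) only perturbs simple
roots (`nodalPoly_perturb`), so the counts differ by two.

The remaining vertices are attached one at a time by tiny weights (`IsRealization.extend`). Each
step creates at most one new positive root, and at even order the parity of the count is fixed by
the signs (`IsRealization.numPos_mod_two`), so the gap of two survives. -/

/-! ### Perturbation and root counts of polynomials with simple real roots. -/

theorem exists_separation (S : Finset ℝ) :
    ∃ ρ : ℝ, 0 < ρ ∧ ∀ s ∈ S, ∀ t ∈ S, s ≠ t → 2 * ρ < |s - t| := by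
  have h : ∀ᶠ ρ : ℝ in 𝓝[>] 0, ∀ s ∈ S, ∀ t ∈ S, s ≠ t → 2 * ρ < |s - t| := by
    refine (Finset.eventually_all S).2 fun s _ => (Finset.eventually_all S).2 fun t _ => ?_
    by_cases hst : s = t
    · simp [hst]
    · have h0 : (0 : ℝ) < |s - t| / 2 := by have := abs_pos.2 (sub_ne_zero.2 hst); linarith
      filter_upwards [nhdsWithin_le_nhds (Iio_mem_nhds h0)] with ρ hρ _
      have : ρ < |s - t| / 2 := hρ
      linarith
  obtain ⟨ρ, h1, h2⟩ := (h.and self_mem_nhdsWithin).exists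
  exact ⟨ρ, h2, h1⟩

/-- The polynomial with simple roots at the points of `T`. -/
noncomputable def nodalPoly (T : Finset ℝ) : ℝ[X] := ∏ t ∈ T, (X - C t)

theorem nodalPoly_monic (T : Finset ℝ) : (nodalPoly T).Monic :=
  monic_prod_of_monic _ _ fun t _ => monic_X_sub_C t

theorem nodalPoly_natDegree (T : Finset ℝ) : (nodalPoly T).natDegree = T.card := by
  rw [nodalPoly, natDegree_prod_of_monic _ (fun t : ℝ => X - C t) fun t _ => monic_X_sub_C t]
  simp

theorem eq_nodalPoly {p : ℝ[X]} (hp : p.Monic) (T : Finset ℝ) (hT : ∀ t ∈ T, p.eval t = 0)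
    (hcard : p.natDegree = T.card) : p = nodalPoly T := by
  have hle : T.val ≤ p.roots := by
    rw [Multiset.le_iff_subset T.nodup]
    intro t ht
    exact (mem_roots hp.ne_zero).2 (hT t ht)
  have hroots : T.val = p.roots :=
    Multiset.eq_of_le_of_card_le hle ((card_roots' p).trans (by rw [hcard]; rfl))
  have := prod_multiset_X_sub_C_of_monic_of_roots_card_eq hp (by rw [← hroots, hcard]; rfl)
  rw [← this, ← hroots]
  rfl

/-- The product factors into terms `(t - s) ^ 2 - ρ ^ 2`, of which only the one with `s = t` is
negative. -/
theorem nodalPoly_eval_mul_neg (T : Finset ℝ) {ρ : ℝ} (hρ : 0 < ρ)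
    (hsep : ∀ s ∈ T, ∀ t ∈ T, s ≠ t → 2 * ρ < |s - t|) {t : ℝ} (ht : t ∈ T) :
    (nodalPoly T).eval (t - ρ) * (nodalPoly T).eval (t + ρ) < 0 := by
  have e : (nodalPoly T).eval (t - ρ) * (nodalPoly T).eval (t + ρ)
      = ∏ s ∈ T, ((t - s) ^ 2 - ρ ^ 2) := by
    simp only [nodalPoly, eval_prod, eval_sub, eval_X, eval_C, ← Finset.prod_mul_distrib]
    exact Finset.prod_congr rfl fun s _ => by ring
  rw [e, ← Finset.mul_prod_erase T _ ht]
  refine mul_neg_of_neg_of_pos (by nlinarith) (Finset.prod_pos fun s hs => ?_)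
  have h := hsep t ht s (Finset.mem_of_mem_erase hs) (Finset.ne_of_mem_erase hs).symm
  rw [← sq_abs (t - s)]
  nlinarith

/-- The number of positive elements. -/
noncomputable def numPos (T : Finset ℝ) : ℕ := (T.filter (0 < ·)).card

/-- The number of negative elements. -/
noncomputable def numNeg (T : Finset ℝ) : ℕ := (T.filter (· < 0)).card

theorem numPos_add_numNeg {T : Finset ℝ} (h0 : (0 : ℝ) ∉ T) : numPos T + numNeg T = T.card := by
  rw [numPos, numNeg, ← Finset.card_filter_add_card_filter_not (s := T) (0 < ·)]
  congr 2
  refine Finset.filter_congr fun t ht => ?_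
  have : t ≠ 0 := fun h => h0 (h ▸ ht)
  simp only [not_lt]
  exact ⟨le_of_lt, fun h => lt_of_le_of_ne h this⟩

/-- Used after a perturbation: when the signed roots already fill the degree, no room is left for
the root zero. -/
theorem zero_notMem_of_card_le {T : Finset ℝ} (h : T.card ≤ numPos T + numNeg T) :
    (0 : ℝ) ∉ T := fun h0 => by
  have hle : numPos T + numNeg T ≤ (T.erase 0).card := by
    rw [numPos, numNeg, ← Finset.card_union_of_disjoint]
    · refine Finset.card_le_card fun t ht => ?_
      rcases Finset.mem_union.1 ht with ht | ht <;> rw [Finset.mem_filter] at ht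
      · exact Finset.mem_erase.2 ⟨ht.2.ne', ht.1⟩
      · exact Finset.mem_erase.2 ⟨ht.2.ne, ht.1⟩
    · exact Finset.disjoint_filter.2 fun t _ h1 h2 => lt_asymm h1 h2
  rw [Finset.card_erase_of_mem h0] at hle
  have := Finset.card_pos.2 ⟨0, h0⟩
  omega

theorem exists_root_between {p : ℝ[X]} {a b : ℝ} (hab : a ≤ b) (h : p.eval a * p.eval b < 0) :
    ∃ z ∈ Set.Ioo a b, p.eval z = 0 := by
  rcases mul_neg_iff.1 h with ⟨h1, h2⟩ | ⟨h1, h2⟩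
  · exact intermediate_value_Ioo' hab p.continuousOn ⟨h2, h1⟩
  · exact intermediate_value_Ioo hab p.continuousOn ⟨h1, h2⟩

/-- A small perturbation of a polynomial with simple real roots has simple real roots,
and nonzero roots keep their signs. -/
theorem nodalPoly_perturb (T : Finset ℝ) (H : ℝ[X]) (hH : H.degree < (T.card : WithBot ℕ)) :
    ∀ᶠ β : ℝ in 𝓝 0, ∃ T' : Finset ℝ, nodalPoly T - C β * H = nodalPoly T' ∧
      T'.card = T.card ∧ numPos T ≤ numPos T' ∧ numNeg T ≤ numNeg T' := by
  -- Including `0` keeps the interval around each nonzero root on its own side of the origin.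
  obtain ⟨ρ, hρ, hsep⟩ := exists_separation (insert 0 T)
  have hsepT : ∀ s ∈ T, ∀ t ∈ T, s ≠ t → 2 * ρ < |s - t| := fun s hs t ht =>
    hsep s (Finset.mem_insert_of_mem hs) t (Finset.mem_insert_of_mem ht)
  have hsep0 : ∀ t ∈ T, t ≠ 0 → 2 * ρ < |t| := fun t ht h => by
    simpa using hsep t (Finset.mem_insert_of_mem ht) 0 (Finset.mem_insert_self _ _) h
  have hev : ∀ᶠ β : ℝ in 𝓝 0, ∀ t ∈ T, (nodalPoly T - C β * H).eval (t - ρ) *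
      (nodalPoly T - C β * H).eval (t + ρ) < 0 := by
    refine (Finset.eventually_all T).2 fun t ht => ?_
    have hc : Continuous fun β : ℝ => (nodalPoly T - C β * H).eval (t - ρ) *
        (nodalPoly T - C β * H).eval (t + ρ) := by
      simp only [eval_sub, eval_mul, eval_C]
      fun_prop
    refine hc.continuousAt.eventually_lt continuousAt_const ?_
    simpa using nodalPoly_eval_mul_neg T hρ hsepT ht
  filter_upwards [hev] with β hβ
  have hz : ∀ t : ℝ, ∃ z : ℝ, t ∈ T →
      z ∈ Set.Ioo (t - ρ) (t + ρ) ∧ (nodalPoly T - C β * H).eval z = 0 := fun t => by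
    by_cases ht : t ∈ T
    · obtain ⟨z, hz⟩ := exists_root_between (by linarith) (hβ t ht)
      exact ⟨z, fun _ => hz⟩
    · exact ⟨0, fun h => absurd h ht⟩
  choose z hz using hz
  have hinj : Set.InjOn z T := by
    intro s hs t ht hst
    by_contra hne
    have h1 := (hz s hs).1
    have h2 := (hz t ht).1
    rw [hst] at h1
    have := hsepT s hs t ht hne
    have : |s - t| < 2 * ρ := by
      rw [abs_lt]; constructor <;> linarith [h1.1, h1.2, h2.1, h2.2]
    linarith
  have hcard : (T.image z).card = T.card := Finset.card_image_of_injOn hinj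
  have hdeg : (C β * H).degree < (nodalPoly T).degree := by
    rw [degree_eq_natDegree (nodalPoly_monic T).ne_zero, nodalPoly_natDegree]
    by_cases hβ0 : β = 0
    · rw [hβ0, C_0, zero_mul, degree_zero]
      exact WithBot.bot_lt_coe _
    · rwa [degree_C_mul hβ0]
  -- The roots found in disjoint intervals are as many as the degree, so there are no others.
  refine ⟨T.image z, eq_nodalPoly ((nodalPoly_monic T).sub_of_left hdeg) _ ?_ ?_, hcard, ?_, ?_⟩
  · simp only [Finset.mem_image]
    rintro _ ⟨t, ht, rfl⟩
    exact (hz t ht).2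
  · rw [hcard, ← nodalPoly_natDegree, natDegree_eq_of_degree_eq (degree_sub_eq_left_of_degree_lt hdeg)]
  · refine Finset.card_le_card_of_injOn z (fun t ht => ?_)
      (hinj.mono fun t ht => (Finset.mem_filter.1 ht).1)
    obtain ⟨ht, h0⟩ := Finset.mem_filter.1 ht
    have h2 := hsep0 t ht h0.ne'
    rw [abs_of_pos h0] at h2
    exact Finset.mem_filter.2 ⟨Finset.mem_image_of_mem z ht, by linarith [(hz t ht).1.1]⟩
  · refine Finset.card_le_card_of_injOn z (fun t ht => ?_)
      (hinj.mono fun t ht => (Finset.mem_filter.1 ht).1)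
    obtain ⟨ht, h0⟩ := Finset.mem_filter.1 ht
    have h2 := hsep0 t ht h0.ne
    rw [abs_of_neg h0] at h2
    exact Finset.mem_filter.2 ⟨Finset.mem_image_of_mem z ht, by linarith [(hz t ht).1.2]⟩

theorem card_roots_expand_two_nodalPoly {T : Finset ℝ} (h0 : (0 : ℝ) ∉ T) :
    Multiset.card (expand ℝ 2 (nodalPoly T)).roots = 2 * numPos T := by
  have hm : ∀ t : ℝ, (X ^ 2 - C t).Monic := fun t => monic_X_pow_sub_C t two_ne_zero
  have e : expand ℝ 2 (nodalPoly T) = ∏ t ∈ T, (X ^ 2 - C t) := by simp [nodalPoly, map_prod]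
  have hroots : ∀ t ∈ T, Multiset.card (X ^ 2 - C t : ℝ[X]).roots = if 0 < t then 2 else 0 := by
    intro t ht
    split_ifs with hp
    · have : (X ^ 2 - C t : ℝ[X]) = (X - C (√t)) * (X - C (-√t)) := by
        nth_rw 1 [← Real.sq_sqrt hp.le]
        simp only [map_neg, map_pow]
        ring
      rw [this, roots_mul (by rw [← this]; exact (hm t).ne_zero)]
      simp only [roots_X_sub_C, Multiset.card_add, Multiset.card_singleton]
    · rw [Multiset.card_eq_zero, Multiset.eq_zero_iff_forall_notMem]
      intro x hx
      have hx := (mem_roots'.1 hx).2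
      simp only [IsRoot.def, eval_sub, eval_pow, eval_X, eval_C] at hx
      have : t ≠ 0 := fun h => h0 (h ▸ ht)
      have : t < 0 := lt_of_le_of_ne (not_lt.1 hp) this
      nlinarith [sq_nonneg x]
  rw [e, roots_prod _ _ (Finset.prod_ne_zero_iff.2 fun t _ => (hm t).ne_zero), Multiset.card_bind,
    numPos, Finset.card_filter, Finset.mul_sum]
  change ∑ t ∈ T, _ = _
  refine Finset.sum_congr rfl fun t ht => ?_
  simp [hroots t ht]

theorem sign_nodalPoly_eval_zero {T : Finset ℝ} (h0 : (0 : ℝ) ∉ T) :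
    SignType.sign ((nodalPoly T).eval 0) = (-1) ^ numPos T := by
  have h : SignType.sign ((nodalPoly T).eval 0) = ∏ t ∈ T, SignType.sign (-t) := by
    simp only [nodalPoly, eval_prod, eval_sub, eval_X, eval_C, zero_sub]
    exact map_prod (signHom (α := ℝ)) (fun t => -t) T
  rw [h, numPos, ← Finset.prod_const, Finset.prod_filter]
  refine Finset.prod_congr rfl fun t ht => ?_
  have : t ≠ 0 := fun h => h0 (h ▸ ht)
  split_ifs with hp
  · exact sign_neg (by linarith)
  · have := lt_of_le_of_ne (not_lt.1 hp) this
    exact sign_pos (by linarith)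

/-! ### Characteristic polynomials of tridiagonal matrices. -/

/-- The leading principal submatrices of an infinite tridiagonal matrix satisfy the three-term
recurrence. -/
theorem det_tridiagonal_succ_succ {R : Type*} [CommRing R] (f : ℕ → ℕ → R)
    (hf : ∀ i j, i + 1 < j ∨ j + 1 < i → f i j = 0) (k : ℕ) :
    (Matrix.of fun i j : Fin (k + 2) => f i j).det =
      f (k + 1) (k + 1) * (Matrix.of fun i j : Fin (k + 1) => f i j).det -
        f k (k + 1) * f (k + 1) k * (Matrix.of fun i j : Fin k => f i j).det := by
  have h1 : (Matrix.of fun i j : Fin (k + 2) => f i j).submatrix (Fin.last (k + 1)).succAbove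
      (Fin.last (k + 1)).succAbove = Matrix.of fun i j : Fin (k + 1) => f i j := by
    ext i j
    simp
  have h2 : ((Matrix.of fun i j : Fin (k + 2) => f i j).submatrix (Fin.last (k + 1)).succAbove
      (Fin.last k).castSucc.succAbove).det =
        f k (k + 1) * (Matrix.of fun i j : Fin k => f i j).det := by
    rw [Matrix.det_succ_column _ (Fin.last k), Fin.sum_univ_castSucc, Finset.sum_eq_zero, zero_add]
    · have h3 : ((Matrix.of fun i j : Fin (k + 2) => f i j).submatrix (Fin.last (k + 1)).succAbove
          (Fin.last k).castSucc.succAbove).submatrix (Fin.last k).succAbove (Fin.last k).succAbove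
          = Matrix.of fun i j : Fin k => f i j := by
        ext i j
        simp [Fin.succAbove, Fin.lt_def]
      rw [h3]
      simp [← two_mul, Fin.succAbove]
    · intro i _
      have : f i (k + 1) = 0 := hf _ _ (Or.inl (by omega))
      simp [Fin.succAbove, this]
  rw [Matrix.det_succ_row _ (Fin.last (k + 1)), Fin.sum_univ_castSucc, Fin.sum_univ_castSucc,
    Finset.sum_eq_zero, zero_add, h1, h2]
  · have e1 : (-1 : R) ^ (k + 1 + (k + 1)) = 1 := Even.neg_one_pow ⟨_, rfl⟩
    have e2 : (-1 : R) ^ (k + 1 + k) = -1 := Odd.neg_one_pow ⟨k, by ring⟩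
    simp only [Matrix.of_apply, Fin.val_last, Fin.val_castSucc, e1, e2]
    ring
  · intro i _
    have : f (k + 1) i = 0 := hf _ _ (Or.inr (by omega))
    simp [this]

/-- The characteristic polynomials of the tridiagonal matrices with zero diagonal, in the
variable `X ^ 2` and up to a factor `X`, in terms of the products `b k = a k (k+1) * a (k+1) k`. -/
noncomputable def pathPoly (b : ℕ → ℝ) : ℕ → ℝ[X]
  | 0 => 1
  | 1 => 1
  | k + 2 => (if Even k then X else 1) * pathPoly b (k + 1) - C (b k) * pathPoly b k

theorem pathPoly_succ_succ (b : ℕ → ℝ) (k : ℕ) : pathPoly b (k + 2) =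
    (if Even k then X else 1) * pathPoly b (k + 1) - C (b k) * pathPoly b k := rfl

theorem pathPoly_congr {b b' : ℕ → ℝ} : ∀ k : ℕ, (∀ i, i + 2 ≤ k → b i = b' i) →
    pathPoly b k = pathPoly b' k
  | 0, _ => rfl
  | 1, _ => rfl
  | k + 2, h => by
    rw [pathPoly_succ_succ, pathPoly_succ_succ, h k le_rfl,
      pathPoly_congr (k + 1) fun i hi => h i (by omega),
      pathPoly_congr k fun i hi => h i (by omega)]

theorem charpoly_tridiagonal (a : ℕ → ℕ → ℝ) (ha : ∀ i j, i + 1 < j ∨ j + 1 < i → a i j = 0)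
    (ha0 : ∀ i, a i i = 0) : ∀ k : ℕ, (Matrix.of fun i j : Fin k => a i j).charpoly =
      X ^ (k % 2) * expand ℝ 2 (pathPoly (fun i => a i (i + 1) * a (i + 1) i) k) := by
  set f : ℕ → ℕ → ℝ[X] := fun i j => (if i = j then X else 0) - C (a i j) with hfdef
  have hf : ∀ i j, i + 1 < j ∨ j + 1 < i → f i j = 0 := fun i j h => by
    simp only [hfdef, ha i j h, C_0, sub_zero]
    exact if_neg (by omega)
  have hc : ∀ k, (Matrix.of fun i j : Fin k => a i j).charpoly =
      (Matrix.of fun i j : Fin k => f i j).det := fun k => by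
    rw [Matrix.charpoly]
    congr 1
    ext1 i j
    by_cases h : i = j
    · simp [h, hfdef]
    · simp [h, hfdef, Matrix.charmatrix_apply_ne, Fin.val_inj]
  simp only [hc]
  intro k
  induction k using Nat.twoStepInduction with
  | zero => simp [pathPoly]
  | one => simp [pathPoly, hfdef, ha0]
  | more k ih1 ih2 =>
    rw [det_tridiagonal_succ_succ f hf, ih1, ih2, pathPoly_succ_succ]
    have e1 : f (k + 1) (k + 1) = X := by simp [hfdef, ha0]
    have e2 : f k (k + 1) * f (k + 1) k = C (a k (k + 1) * a (k + 1) k) := by simp [hfdef]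
    rw [e1, e2]
    rcases Nat.even_or_odd k with h | h
    · have h0 : k % 2 = 0 := Nat.even_iff.1 h
      have h1 : (k + 1) % 2 = 1 := by omega
      have h2 : (k + 2) % 2 = 0 := by omega
      simp only [h0, h1, h2, if_pos h, map_sub, map_mul, expand_X, expand_C]
      ring
    · have h0 : k % 2 = 1 := Nat.odd_iff.1 h
      have h1 : (k + 1) % 2 = 0 := by omega
      have h2 : (k + 2) % 2 = 1 := by omega
      simp only [h0, h1, h2, if_neg (Nat.not_even_iff_odd.2 h), map_sub, map_mul, expand_C, map_one]
      ring

theorem pathPoly_degree_le (b : ℕ → ℝ) : ∀ k, (pathPoly b k).natDegree ≤ k / 2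
  | 0 => by simp [pathPoly]
  | 1 => by simp [pathPoly]
  | k + 2 => by
    have h1 := pathPoly_degree_le b (k + 1)
    have h2 := pathPoly_degree_le b k
    rw [pathPoly_succ_succ]
    refine (natDegree_sub_le _ _).trans (max_le ?_ ?_)
    · split_ifs with h
      · have := Nat.even_iff.1 h
        refine natDegree_mul_le.trans ?_
        rw [natDegree_X]
        omega
      · rw [one_mul]; omega
    · exact (natDegree_C_mul_le _ _).trans (by omega)

/-- At even index the factor `X` kills the first term of the recurrence at zero. -/
theorem sign_pathPoly_eval_zero (b : ℕ → ℝ) (k : ℕ) :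
    SignType.sign ((pathPoly b (2 * k)).eval 0) =
      ∏ i ∈ Finset.range k, -SignType.sign (b (2 * i)) := by
  induction k with
  | zero => simp [pathPoly]
  | succ k ih =>
    rw [Finset.prod_range_succ, ← ih, mul_add_one, pathPoly_succ_succ, if_pos (even_two_mul k)]
    simp [Left.sign_neg, sign_mul, mul_comm]

/-! ### Realizing edge signs with simple nonzero roots, and growing the path. -/

/-- The weights `b` have signs `σ`, and the corresponding polynomial of order `m` has the simple
nonzero real roots `T` and no others. -/
structure IsRealization (σ : ℕ → SignType) (m : ℕ) (b : ℕ → ℝ) (T : Finset ℝ) : Prop where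
  sign_eq : ∀ k, SignType.sign (b k) = σ k
  poly_eq : pathPoly b m = nodalPoly T
  zero_notMem : (0 : ℝ) ∉ T
  card_eq : T.card = m / 2

theorem exists_sign_eq_of_eventually {Q : ℝ → Prop} (hQ : ∀ᶠ β : ℝ in 𝓝 0, Q β) {s : SignType}
    (hs : s ≠ 0) : ∃ β, SignType.sign β = s ∧ Q β := by
  obtain ⟨ε, hε, h⟩ := Metric.eventually_nhds_iff.1 hQ
  cases s
  · exact absurd rfl hs
  · exact ⟨-(ε / 2), sign_neg (by linarith),
      h (by rw [Real.dist_eq, sub_zero, abs_neg, abs_of_pos] <;> linarith)⟩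
  · exact ⟨ε / 2, sign_pos (by linarith),
      h (by rw [Real.dist_eq, sub_zero, abs_of_pos] <;> linarith)⟩

theorem degree_lt_of_natDegree_lt {p : ℝ[X]} {d : ℕ} (h : p.natDegree < d) :
    p.degree < (d : WithBot ℕ) :=
  degree_le_natDegree.trans_lt (by exact_mod_cast h)

theorem sign_update {σ : ℕ → SignType} {b : ℕ → ℝ} (hb : ∀ k, SignType.sign (b k) = σ k)
    {i : ℕ} {β : ℝ} (hβ : SignType.sign β = σ i) (k : ℕ) :
    SignType.sign (Function.update b i β k) = σ k := by
  by_cases h : k = i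
  · subst h; simpa using hβ
  · simpa [h] using hb k

theorem numPos_insert_of_notMem {T : Finset ℝ} {t : ℝ} (ht : t ∉ T) :
    numPos (insert t T) = numPos T + if 0 < t then 1 else 0 := by
  unfold numPos
  rw [Finset.filter_insert]
  split_ifs with h
  · exact Finset.card_insert_of_notMem fun h' => ht (Finset.mem_filter.1 h').1
  · rfl

theorem nodalPoly_insert {T : Finset ℝ} {t : ℝ} (ht : t ∉ T) :
    nodalPoly (insert t T) = (X - C t) * nodalPoly T := Finset.prod_insert ht

/-- The sign of the constant term is `(-1) ^ numPos T`, and at even order `σ` alone determines it.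
-/
theorem IsRealization.numPos_mod_two {σ : ℕ → SignType} {m : ℕ} {b b' : ℕ → ℝ} {T T' : Finset ℝ}
    (hm : Even m) (h : IsRealization σ m b T) (h' : IsRealization σ m b' T') :
    numPos T % 2 = numPos T' % 2 := by
  obtain ⟨k, rfl⟩ := even_iff_two_dvd.1 hm
  have e := sign_pathPoly_eval_zero b k
  have e' := sign_pathPoly_eval_zero b' k
  simp only [h.sign_eq, h'.sign_eq] at e e'
  rw [← e', h.poly_eq, h'.poly_eq, sign_nodalPoly_eval_zero h.zero_notMem,
    sign_nodalPoly_eval_zero h'.zero_notMem] at e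
  rcases Nat.even_or_odd (numPos T) with h1 | h1 <;>
  rcases Nat.even_or_odd (numPos T') with h2 | h2
  · rw [Nat.even_iff.1 h1, Nat.even_iff.1 h2]
  · rw [h1.neg_one_pow, h2.neg_one_pow] at e; exact absurd e (by decide)
  · rw [h1.neg_one_pow, h2.neg_one_pow] at e; exact absurd e (by decide)
  · rw [Nat.odd_iff.1 h1, Nat.odd_iff.1 h2]

theorem zero_notMem_of_pathPoly_eq {σ : ℕ → SignType} (hσ : ∀ k, σ k ≠ 0) {m : ℕ}
    (hm : Even m) {b : ℕ → ℝ} {T : Finset ℝ} (hb : ∀ k, SignType.sign (b k) = σ k)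
    (h : pathPoly b m = nodalPoly T) : (0 : ℝ) ∉ T := by
  obtain ⟨k, rfl⟩ := even_iff_two_dvd.1 hm
  intro h0
  have e := sign_pathPoly_eval_zero b k
  have : (nodalPoly T).eval 0 = 0 := by
    rw [nodalPoly, eval_prod]
    exact Finset.prod_eq_zero h0 (by simp)
  rw [h, this, sign_zero] at e
  refine Finset.prod_ne_zero_iff.2 (fun i _ => ?_) e.symm
  rw [hb]
  have h2 := hσ (2 * i)
  revert h2
  generalize σ (2 * i) = s
  revert s
  decide

/-- Adding a vertex at the end of the path, with a small weight on the new edge. -/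
theorem IsRealization.extend {σ : ℕ → SignType} (hσ : ∀ k, σ k ≠ 0) {m : ℕ} {b : ℕ → ℝ}
    {T : Finset ℝ} (h : IsRealization σ m b T) :
    ∃ b' T', IsRealization σ (m + 1) b' T' ∧ numPos T ≤ numPos T' ∧ numPos T' ≤ numPos T + 1 ∧
      (Even m → numPos T' = numPos T) := by
  have hpn := numPos_add_numNeg h.zero_notMem
  have hcT := h.card_eq
  rcases m with _ | k
  · exact ⟨b, T, ⟨h.sign_eq, h.poly_eq, h.zero_notMem, h.card_eq⟩, le_rfl, by omega, fun _ => rfl⟩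
  have hpoly : ∀ β, pathPoly (Function.update b k β) (k + 2) =
      (if Even k then X else 1) * nodalPoly T - C β * pathPoly b k := fun β => by
    rw [pathPoly_succ_succ, ← h.poly_eq, Function.update_self,
      pathPoly_congr (b := Function.update b k β) (b' := b) (k + 1) fun i hi =>
        Function.update_of_ne (by omega) _ _,
      pathPoly_congr (b := Function.update b k β) (b' := b) k fun i hi =>
        Function.update_of_ne (by omega) _ _]
  have hdeg := pathPoly_degree_le b k
  rcases Nat.even_or_odd k with hk | hk
  · have hk2 := Nat.even_iff.1 hk
    have hc : (insert 0 T).card = T.card + 1 := Finset.card_insert_of_notMem h.zero_notMem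
    obtain ⟨β, hβ, T', hT', hc', hp, hn⟩ := exists_sign_eq_of_eventually
      (nodalPoly_perturb (insert 0 T) (pathPoly b k)
        (degree_lt_of_natDegree_lt (by omega))) (hσ k)
    have hs := sign_update h.sign_eq hβ
    have hG : pathPoly (Function.update b k β) (k + 2) = nodalPoly T' := by
      rw [hpoly, if_pos hk, ← hT', nodalPoly_insert h.zero_notMem, C_0, sub_zero]
    have h0 : (0 : ℝ) ∉ T' :=
      zero_notMem_of_pathPoly_eq hσ (by simpa [Nat.even_add] using hk) hs hG
    have hpn' := numPos_add_numNeg h0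
    have hp0 : numPos (insert 0 T) = numPos T := by
      simpa using numPos_insert_of_notMem h.zero_notMem
    have hn0 : numNeg (insert 0 T) = numNeg T := by simp [numNeg, Finset.filter_insert]
    refine ⟨_, T', ⟨hs, hG, h0, by omega⟩, by omega, by omega, fun hodd => ?_⟩
    rw [Nat.even_iff] at hodd
    omega
  · have hk2 := Nat.odd_iff.1 hk
    -- Here the degree does not grow, so both sign counts are preserved.
    obtain ⟨β, hβ, T', hT', hc', hp, hn⟩ := exists_sign_eq_of_eventually
      (nodalPoly_perturb T (pathPoly b k) (degree_lt_of_natDegree_lt (by omega))) (hσ k)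
    have hs := sign_update h.sign_eq hβ
    have hG : pathPoly (Function.update b k β) (k + 2) = nodalPoly T' := by
      rw [hpoly, if_neg (Nat.not_even_iff_odd.2 hk), ← hT', one_mul]
    have h0 : (0 : ℝ) ∉ T' := zero_notMem_of_card_le (by omega)
    have hpn' := numPos_add_numNeg h0
    exact ⟨_, T', ⟨hs, hG, h0, by omega⟩, by omega, by omega, fun _ => by omega⟩

theorem exists_isRealization {σ : ℕ → SignType} (hσ : ∀ k, σ k ≠ 0) (m : ℕ) :
    ∃ b T, IsRealization σ m b T := by
  induction m with
  | zero =>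
    choose b hb using fun k => exists_sign_eq_of_eventually (Q := fun _ => True)
      (Eventually.of_forall fun _ => trivial) (hσ k)
    exact ⟨b, ∅, fun k => (hb k).1, by simp [pathPoly, nodalPoly], by simp, by simp⟩
  | succ m ih =>
    obtain ⟨b, T, h⟩ := ih
    obtain ⟨b', T', h', -⟩ := h.extend hσ
    exact ⟨b', T', h'⟩

/-- Order `m` involves only the weights `b i` with `i + 2 ≤ m`; later ones are free. -/
theorem IsRealization.update {σ : ℕ → SignType} {m : ℕ} {b : ℕ → ℝ} {T : Finset ℝ}
    (h : IsRealization σ m b T) {i : ℕ} (hi : m ≤ i + 1) {β : ℝ} (hβ : SignType.sign β = σ i) :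
    IsRealization σ m (Function.update b i β) T where
  sign_eq := sign_update h.sign_eq hβ
  poly_eq := by
    rw [← h.poly_eq]
    exact pathPoly_congr m fun j hj => Function.update_of_ne (by omega) _ _
  zero_notMem := h.zero_notMem
  card_eq := h.card_eq

theorem even_ite_mul_even_ite (k : ℕ) :
    (if Even k then X else 1 : ℝ[X]) * (if Even (k + 1) then X else 1) = X := by
  by_cases h : Even k <;> simp [h, Nat.even_add_one]

/-- Adding four vertices at the end of the path, joined to it by an edge of small weight. -/
theorem IsRealization.extend_four {σ : ℕ → SignType} (hσ : ∀ k, σ k ≠ 0) {m : ℕ} {b : ℕ → ℝ}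
    {T : Finset ℝ} (h : IsRealization σ m b T) {t₁ t₂ : ℝ} (h₁ : t₁ ∉ T) (h₂ : t₂ ∉ T)
    (hne : t₁ ≠ t₂) (h₁0 : t₁ ≠ 0) (h₂0 : t₂ ≠ 0)
    (hsum : b m + b (m + 1) + b (m + 2) = t₁ + t₂) (hprod : b m * b (m + 2) = t₁ * t₂) :
    ∃ b' T', IsRealization σ (m + 4) b' T' ∧
      numPos T' = numPos T + (if 0 < t₁ then 1 else 0) + (if 0 < t₂ then 1 else 0) := by
  have h₂' : t₂ ∉ insert t₁ T := by simp [h₂, hne.symm]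
  set S := insert t₂ (insert t₁ T) with hS
  have hcT := h.card_eq
  have hcS : S.card = m / 2 + 2 := by
    rw [hS, Finset.card_insert_of_notMem h₂', Finset.card_insert_of_notMem h₁, hcT]
  have hpS : numPos S = numPos T + (if 0 < t₁ then 1 else 0) + (if 0 < t₂ then 1 else 0) := by
    rw [hS, numPos_insert_of_notMem h₂', numPos_insert_of_notMem h₁]
  have h0S : (0 : ℝ) ∉ S := by simp [hS, h.zero_notMem, h₁0.symm, h₂0.symm]
  have hsum' : C (b m) + C (b (m + 1)) + C (b (m + 2)) = C t₁ + C t₂ := by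
    simp only [← C_add, hsum]
  have hprod' : C (b m) * C (b (m + 2)) = C t₁ * C t₂ := by simp only [← C_mul, hprod]
  have hnS : nodalPoly S =
      (X ^ 2 - (C (b m) + C (b (m + 1)) + C (b (m + 2))) * X + C (b m) * C (b (m + 2))) *
        nodalPoly T := by
    rw [hS, nodalPoly_insert h₂', nodalPoly_insert h₁, hsum', hprod']
    ring
  rw [← hpS]
  rcases m with _ | k
  · refine ⟨b, S, ⟨h.sign_eq, ?_, h0S, by omega⟩, rfl⟩
    rw [hnS, ← h.poly_eq]
    simp [pathPoly, Nat.even_iff]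
    ring
  · have hk := even_ite_mul_even_ite k
    set τ : ℝ[X] := if Even k then X else 1 with hτ
    set τ' : ℝ[X] := if Even (k + 1) then X else 1 with hτ'
    -- The coefficient of the joining weight: deleting both ends of that edge leaves a path on `k`
    -- vertices and one on three.
    set H : ℝ[X] := τ' * (X - C (b (k + 2) + b (k + 3))) * pathPoly b k with hH
    have hdeg := pathPoly_degree_le b k
    have hdτ : τ'.natDegree = k % 2 := by
      rcases Nat.even_or_odd k with h | h
      · simp [hτ', Nat.even_add_one, h, Nat.even_iff.1 h]
      · simp [hτ', Nat.even_add_one, Nat.not_even_iff_odd.2 h, Nat.odd_iff.1 h]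
    have hdH : H.natDegree < S.card := by
      have e1 : H.natDegree ≤ _ := natDegree_mul_le
      have e2 : (τ' * (X - C (b (k + 2) + b (k + 3)))).natDegree ≤ _ := natDegree_mul_le
      rw [natDegree_X_sub_C] at e2
      omega
    obtain ⟨β, hβ, T', hT', hc', hp, hn⟩ := exists_sign_eq_of_eventually
      (nodalPoly_perturb S H (degree_lt_of_natDegree_lt hdH)) (hσ k)
    have hpn := numPos_add_numNeg h0S
    have h0 : (0 : ℝ) ∉ T' := zero_notMem_of_card_le (by omega)
    have hpn' := numPos_add_numNeg h0
    refine ⟨Function.update b k β, T', ⟨sign_update h.sign_eq hβ, ?_, h0, by omega⟩, by omega⟩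
    have e0 : pathPoly (Function.update b k β) k = pathPoly b k :=
      pathPoly_congr k fun i hi => Function.update_of_ne (by omega) _ _
    have e1 : pathPoly (Function.update b k β) (k + 1) = nodalPoly T := by
      rw [← h.poly_eq]
      exact pathPoly_congr (k + 1) fun i hi => Function.update_of_ne (by omega) _ _
    have p2 : Even (k + 2) ↔ Even k := by simp [Nat.even_add]
    have p3 : Even (k + 1 + 2) ↔ Even (k + 1) := by simp [Nat.even_add]
    have u1 : Function.update b k β (k + 1) = b (k + 1) := Function.update_of_ne (by omega) _ _
    have u2 : Function.update b k β (k + 2) = b (k + 2) := Function.update_of_ne (by omega) _ _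
    have u3 : Function.update b k β (k + 3) = b (k + 3) := Function.update_of_ne (by omega) _ _
    have g2 := pathPoly_succ_succ (Function.update b k β) k
    have g3 := pathPoly_succ_succ (Function.update b k β) (k + 1)
    have g4 := pathPoly_succ_succ (Function.update b k β) (k + 2)
    have g5 := pathPoly_succ_succ (Function.update b k β) (k + 1 + 2)
    rw [Function.update_self, e0, e1] at g2
    rw [u1, e1] at g3
    simp only [p2, u2] at g4
    simp only [p3, u3, add_assoc, Nat.reduceAdd] at g5
    simp only [add_assoc, Nat.reduceAdd] at g3 g4
    rw [← hτ] at g2 g4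
    simp only [← hτ'] at g3 g5
    rw [← hT', hnS, hH, show k + 1 + 4 = k + 5 from rfl, g5, g4, g3, g2]
    simp only [add_assoc, Nat.reduceAdd, C_add]
    linear_combination (nodalPoly T * X - C (b (k + 1)) * nodalPoly T -
      C (b (k + 2)) * nodalPoly T - C (b (k + 3)) * nodalPoly T + τ * τ' * nodalPoly T -
      C β * τ' * pathPoly b k) * hk

theorem sign_mul_pos_real {s : SignType} {x : ℝ} (hx : 0 < x) :
    SignType.sign ((s : ℝ) * x) = s := by
  cases s
  · simp
  · simpa using sign_neg (neg_lt_zero.2 hx)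
  · simpa using sign_pos hx

/-- Three consecutive edges with alternating signs allow two sets of weights for which the numbers
of positive roots differ by two. -/
theorem exists_isRealization_pair_of_alternating {σ : ℕ → SignType} (hσ : ∀ k, σ k ≠ 0) {m : ℕ}
    (h₁ : σ (m + 1) = -σ m) (h₂ : σ (m + 2) = σ m) :
    ∃ b T b' T', IsRealization σ (m + 4) b T ∧ IsRealization σ (m + 4) b' T' ∧
      numPos T = numPos T' + 2 := by
  obtain ⟨b, T, h⟩ := exists_isRealization hσ m
  -- This exceeds every `|t|`, so new roots of modulus at least `l` avoid `T`.
  set l : ℝ := 1 + ∑ t ∈ T, |t| with hl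
  have hl0 : 0 < l := by
    have : 0 ≤ ∑ t ∈ T, |t| := Finset.sum_nonneg fun t _ => abs_nonneg t
    linarith
  have hT : ∀ t, l ≤ |t| → t ∉ T := fun t ht hmem => by
    have := Finset.single_le_sum (f := fun t : ℝ => |t|) (fun t _ => abs_nonneg t) hmem
    linarith
  have key : ∀ x y z t₁ t₂ : ℝ, 0 < x → 0 < y → 0 < z → x - y + z = t₁ + t₂ → x * z = t₁ * t₂ →
      l ≤ |t₁| → l ≤ |t₂| → t₁ ≠ t₂ → ∃ b' T', IsRealization σ (m + 4) b' T' ∧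
        numPos T' = numPos T + (if 0 < (σ m : ℝ) * t₁ then 1 else 0) +
          (if 0 < (σ m : ℝ) * t₂ then 1 else 0) := by
    intro x y z t₁ t₂ hx hy hz hs hp ht₁ ht₂ hne
    have r1 := h.update (i := m) (β := σ m * x) (by omega) (sign_mul_pos_real hx)
    have r2 := r1.update (i := m + 1) (β := σ (m + 1) * y) (by omega) (sign_mul_pos_real hy)
    have r3 := r2.update (i := m + 2) (β := σ (m + 2) * z) (by omega) (sign_mul_pos_real hz)
    have hσm : (σ m : ℝ) = 1 ∨ (σ m : ℝ) = -1 := by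
      have := hσ m
      cases h : σ m <;> simp_all
    have hσ1 : (σ (m + 1) : ℝ) = -(σ m : ℝ) := by rw [h₁]; cases σ m <;> simp
    have habs : ∀ t : ℝ, |(σ m : ℝ) * t| = |t| := fun t => by
      rcases hσm with e | e <;> rw [e] <;> simp
    have hnz : ∀ t : ℝ, l ≤ |t| → t ≠ 0 := fun t ht => abs_pos.1 (hl0.trans_le ht)
    refine r3.extend_four hσ (hT _ (by rwa [habs])) (hT _ (by rwa [habs])) ?_ ?_ ?_ ?_ ?_
    · rcases hσm with e | e <;> rw [e] <;> simpa using hne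
    · exact hnz _ (by rwa [habs])
    · exact hnz _ (by rwa [habs])
    · simp [hσ1, h₂]
      linear_combination (σ m : ℝ) * hs
    · simp [h₂]
      linear_combination (σ m : ℝ) ^ 2 * hp
  -- Both choices have product `4 * l ^ 2`; the sums are `5 * l` and `-5 * l`, giving roots `l, 4 *
  -- l` and their negatives, up to the factor `σ m`.
  obtain ⟨b₁, T₁, r₁, e₁⟩ := key (8 * l) (7 / 2 * l) (1 / 2 * l) l (4 * l) (by positivity)
    (by positivity) (by positivity) (by ring) (by ring) (le_abs_self _)
    ((by linarith : l ≤ 4 * l).trans (le_abs_self _)) (by linarith)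
  obtain ⟨b₂, T₂, r₂, e₂⟩ := key (2 * l) (9 * l) (2 * l) (-l) (-(4 * l)) (by positivity)
    (by positivity) (by positivity) (by ring) (by ring) (by rw [abs_neg]; exact le_abs_self _)
    (by rw [abs_neg]; exact (by linarith : l ≤ 4 * l).trans (le_abs_self _)) (by linarith)
  have hl4 : ¬ 4 * l < 0 := by linarith
  have := hσ m
  cases hs : σ m
  · exact absurd hs this
  · refine ⟨b₂, T₂, b₁, T₁, r₂, r₁, ?_⟩
    rw [e₁, e₂]
    simp [hs, hl0, hl0.le, hl4]
  · refine ⟨b₁, T₁, b₂, T₂, r₁, r₂, ?_⟩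
    rw [e₁, e₂]
    simp [hs, hl0, hl0.le, hl4]

theorem exists_isRealization_pair {σ : ℕ → SignType} (hσ : ∀ k, σ k ≠ 0) {m n : ℕ} (hmn : m ≤ n)
    (h : ∃ b T b' T', IsRealization σ m b T ∧ IsRealization σ m b' T' ∧
      numPos T = numPos T' + 2) :
    ∃ b T b' T', IsRealization σ n b T ∧ IsRealization σ n b' T' ∧
      numPos T = numPos T' + 2 := by
  induction n, hmn using Nat.le_induction with
  | base => exact h
  | succ n _ ih =>
    obtain ⟨b, T, b', T', r, r', e⟩ := ih
    obtain ⟨c, S, s, h1, h2, h3⟩ := r.extend hσ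
    obtain ⟨c', S', s', h1', h2', h3'⟩ := r'.extend hσ
    refine ⟨c, S, c', S', s, s', ?_⟩
    rcases Nat.even_or_odd n with hn | hn
    · rw [h3 hn, h3' hn, e]
    -- The new difference is 1, 2 or 3, and it is even.
    · have := s.numPos_mod_two (by simpa [Nat.even_add_one] using hn) s'
      omega

/-! ### From sign patterns to edge weights and back. -/

variable {n : ℕ}

theorem succ_eq_of_ne_zero {P : SignPattern n} (htri : IsTridiagonal P) (hdiag : HasZeroDiagonal P)
    {i j : Fin n} (h : P i j ≠ 0) : (j : ℕ) = i + 1 ∨ (i : ℕ) = j + 1 := by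
  by_contra hc
  rcases eq_or_ne i j with rfl | hij
  · exact h (hdiag i)
  · have := Fin.val_ne_of_ne hij
    exact h (htri i j (by omega))

/-- Only the edge between `k` and `k + 1` can cross the cut after `k`; both directions of the cut
are used. -/
theorem IsIrreducible.ne_zero {P : SignPattern n} (hirr : IsIrreducible P)
    (htri : IsTridiagonal P) (k : ℕ) (hk : k + 1 < n) :
    P ⟨k, by omega⟩ ⟨k + 1, hk⟩ ≠ 0 ∧ P ⟨k + 1, hk⟩ ⟨k, by omega⟩ ≠ 0 := by
  have h1 : ({i | (i : ℕ) ≤ k} : Set (Fin n)).Nonempty := ⟨⟨k, by omega⟩, by simp⟩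
  have h2 : ({i | (i : ℕ) ≤ k}ᶜ : Set (Fin n)).Nonempty := ⟨⟨k + 1, hk⟩, by simp⟩
  constructor
  · obtain ⟨i, hi, j, hj, hij⟩ := hirr _ h1 h2
    have hi : (i : ℕ) ≤ k := hi
    have hj : ¬ (j : ℕ) ≤ k := hj
    have h3 : ¬ ((i : ℕ) + 1 < j ∨ (j : ℕ) + 1 < i) := fun h => hij (htri i j h)
    have ei : i = ⟨k, by omega⟩ := Fin.ext (by simp only; omega)
    have ej : j = ⟨k + 1, hk⟩ := Fin.ext (by simp only; omega)
    rwa [ei, ej] at hij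
  · obtain ⟨i, hi, j, hj, hij⟩ := hirr _ h2 (by rwa [compl_compl])
    rw [compl_compl] at hj
    have hi : ¬ (i : ℕ) ≤ k := hi
    have hj : (j : ℕ) ≤ k := hj
    have h3 : ¬ ((i : ℕ) + 1 < j ∨ (j : ℕ) + 1 < i) := fun h => hij (htri i j h)
    have ei : i = ⟨k + 1, hk⟩ := Fin.ext (by simp only; omega)
    have ej : j = ⟨k, by omega⟩ := Fin.ext (by simp only; omega)
    rwa [ei, ej] at hij

/-- The entries of a matrix in the class of a tridiagonal pattern with superdiagonal `u` and
subdiagonal `v`, with weights `b`. -/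
noncomputable def tridiagonalEntries (u v : ℕ → SignType) (b : ℕ → ℝ) (i j : ℕ) : ℝ :=
  if j = i + 1 then (u i : ℝ) else if i = j + 1 then (v j : ℝ) * |b j| else 0

theorem numRealEigenvalues_of_isRealization {u v : ℕ → SignType} {b : ℕ → ℝ} {T : Finset ℝ}
    (h : IsRealization (fun k => u k * v k) n b T) :
    numRealEigenvalues (Matrix.of fun i j : Fin n => tridiagonalEntries u v b i j) =
      n % 2 + 2 * numPos T := by
  have hb : (fun i => tridiagonalEntries u v b i (i + 1) * tridiagonalEntries u v b (i + 1) i)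
      = b := by
    funext i
    have e : ((u i * v i : SignType) : ℝ) * |b i| = b i := by
      rw [← h.sign_eq i]
      exact sign_mul_abs (b i)
    rw [SignType.coe_mul] at e
    have hi : i ≠ i + 1 + 1 := by omega
    simpa [tridiagonalEntries, mul_assoc, hi] using e
  rw [numRealEigenvalues, charpoly_tridiagonal (tridiagonalEntries u v b)
    (fun i j hij => by
      rw [tridiagonalEntries, if_neg (by omega), if_neg (by omega)])
    (fun i => by rw [tridiagonalEntries, if_neg (by omega), if_neg (by omega)]), hb, h.poly_eq,
    roots_mul, roots_X_pow, Multiset.card_add, Multiset.card_nsmul, Multiset.card_singleton,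
    card_roots_expand_two_nodalPoly h.zero_notMem, mul_one]
  exact mul_ne_zero (pow_ne_zero _ X_ne_zero)
    ((expand_ne_zero two_pos).2 (nodalPoly_monic T).ne_zero)

theorem tridiagonalEntries_mem_qualClass {P : SignPattern n} (htri : IsTridiagonal P)
    (hdiag : HasZeroDiagonal P) {u v : ℕ → SignType}
    (hu : ∀ k (hk : k + 1 < n), u k = P ⟨k, by omega⟩ ⟨k + 1, hk⟩)
    (hv : ∀ k (hk : k + 1 < n), v k = P ⟨k + 1, hk⟩ ⟨k, by omega⟩)
    {b : ℕ → ℝ} (hb : ∀ k, b k ≠ 0) :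
    (Matrix.of fun i j : Fin n => tridiagonalEntries u v b i j) ∈ qualClass P := by
  intro i j
  rw [Matrix.of_apply, tridiagonalEntries]
  split_ifs with h1 h2
  · have ej : j = ⟨i + 1, h1 ▸ j.2⟩ := Fin.ext h1
    have e := hu i (h1 ▸ j.2)
    rw [← ej] at e
    rw [← e]
    simpa using sign_mul_pos_real (s := u i) one_pos
  · have ei : i = ⟨j + 1, h2 ▸ i.2⟩ := Fin.ext h2
    have e := hv j (h2 ▸ i.2)
    rw [← ei] at e
    rw [← e]
    exact sign_mul_pos_real (abs_pos.2 (hb j))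
  · rw [sign_zero]
    by_contra hne
    exact (succ_eq_of_ne_zero htri hdiag (Ne.symm hne)).elim h1 h2

/-- A submatrix of a tridiagonal pattern with zero diagonal that contains the edges of a path on
four vertices is a principal submatrix with consecutive indices. -/
theorem IsSubmatrix.exists_alternating {P : SignPattern n} (htri : IsTridiagonal P)
    (hdiag : HasZeroDiagonal P) {M : SignPattern 4} (hM : IsSubmatrix M P)
    (h01 : edgeSign M 0 1 ≠ 0) (h12 : edgeSign M 1 2 = -edgeSign M 0 1)
    (h23 : edgeSign M 2 3 = edgeSign M 0 1) :
    ∃ (m : ℕ) (hm : m + 3 < n),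
      edgeSign P ⟨m + 1, by omega⟩ ⟨m + 2, by omega⟩ =
        -edgeSign P ⟨m, by omega⟩ ⟨m + 1, by omega⟩ ∧
      edgeSign P ⟨m + 2, by omega⟩ ⟨m + 3, hm⟩ =
        edgeSign P ⟨m, by omega⟩ ⟨m + 1, by omega⟩ := by
  obtain ⟨r, c, hr, hc, rfl⟩ := hM
  have hneg : ∀ s : SignType, s ≠ 0 → -s ≠ 0 := by decide
  have n12 := h12 ▸ hneg _ h01
  have n23 := h23 ▸ h01
  have nz : ∀ i j, edgeSign (P.submatrix r c) i j ≠ 0 →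
      ((c j : ℕ) = r i + 1 ∨ (r i : ℕ) = c j + 1) ∧ ((c i : ℕ) = r j + 1 ∨ (r j : ℕ) = c i + 1) :=
    fun i j h => ⟨succ_eq_of_ne_zero htri hdiag (left_ne_zero_of_mul h),
      succ_eq_of_ne_zero htri hdiag (right_ne_zero_of_mul h)⟩
  have a01 := nz 0 1 h01
  have a12 := nz 1 2 n12
  have a23 := nz 2 3 n23
  have r01 : (r 0 : ℕ) < r 1 := hr (by decide)
  have r12 : (r 1 : ℕ) < r 2 := hr (by decide)
  have r23 : (r 2 : ℕ) < r 3 := hr (by decide)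
  have c01 : (c 0 : ℕ) < c 1 := hc (by decide)
  have c12 : (c 1 : ℕ) < c 2 := hc (by decide)
  have c23 : (c 2 : ℕ) < c 3 := hc (by decide)
  -- For each consecutive pair, `r 0 ≤ r 1 - 1 ≤ c 0 < c 1 ≤ r 0 + 1` and its analogues force
  -- equality.
  have hlt : (r 0 : ℕ) + 3 < n := by have := (r 3).2; omega
  have er0 : r 0 = ⟨r 0, by omega⟩ := rfl
  have er1 : r 1 = ⟨r 0 + 1, by omega⟩ := Fin.ext (by simp only; omega)
  have er2 : r 2 = ⟨r 0 + 2, by omega⟩ := Fin.ext (by simp only; omega)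
  have er3 : r 3 = ⟨r 0 + 3, by omega⟩ := Fin.ext (by simp only; omega)
  have ec0 : c 0 = r 0 := Fin.ext (by omega)
  have ec1 : c 1 = r 1 := Fin.ext (by omega)
  have ec2 : c 2 = r 2 := Fin.ext (by omega)
  have ec3 : c 3 = r 3 := Fin.ext (by omega)
  refine ⟨r 0, hlt, ?_, ?_⟩
  · simpa only [edgeSign, Matrix.submatrix_apply, ec0, ec1, ec2, er1, er2] using h12
  · simpa only [edgeSign, Matrix.submatrix_apply, ec0, ec1, ec2, ec3, er1, er2, er3] using h23

end SignPat

theorem theorem3p7 {n : ℕ} (P : SignPat.SignPattern n)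
    (hirr : SignPat.IsIrreducible P) (htri : SignPat.IsTridiagonal P)
    (hdiag : SignPat.HasZeroDiagonal P)
    (hsub : SignPat.IsSubmatrix SignPat.P4 P ∨
      ∃ N : SignPat.SignPattern 4,
        SignPat.IsEdgeNegation SignPat.P4 N ∧ SignPat.IsSubmatrix N P) :
    ¬ SignPat.IsConsistent P := by
  open SignPat in
  rintro ⟨k, -, hk⟩
  obtain ⟨m, hm, e1, e2⟩ : ∃ (m : ℕ) (hm : m + 3 < n),
      edgeSign P ⟨m + 1, by omega⟩ ⟨m + 2, by omega⟩ =
        -edgeSign P ⟨m, by omega⟩ ⟨m + 1, by omega⟩ ∧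
      edgeSign P ⟨m + 2, by omega⟩ ⟨m + 3, hm⟩ =
        edgeSign P ⟨m, by omega⟩ ⟨m + 1, by omega⟩ := by
    rcases hsub with h | ⟨N, ⟨-, -, hN⟩, h⟩
    · exact h.exists_alternating htri hdiag (by decide) (by decide) (by decide)
    · refine h.exists_alternating htri hdiag ?_ ?_ ?_
      · rw [hN]; decide
      · rw [hN, hN]; decide
      · rw [hN, hN]; decide
  -- The default `1` keeps the sign sequence nonzero beyond the last edge.
  set u : ℕ → SignType := fun k => if h : k + 1 < n then P ⟨k, by omega⟩ ⟨k + 1, h⟩ else 1 with hu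
  set v : ℕ → SignType := fun k => if h : k + 1 < n then P ⟨k + 1, h⟩ ⟨k, by omega⟩ else 1 with hv
  have hu' : ∀ k (hk : k + 1 < n), u k = P ⟨k, by omega⟩ ⟨k + 1, hk⟩ := fun k h => dif_pos h
  have hv' : ∀ k (hk : k + 1 < n), v k = P ⟨k + 1, hk⟩ ⟨k, by omega⟩ := fun k h => dif_pos h
  have huv : ∀ k (hk : k + 1 < n), u k * v k = edgeSign P ⟨k, by omega⟩ ⟨k + 1, hk⟩ :=
    fun k h => by rw [hu' k h, hv' k h, edgeSign]
  have hσ : ∀ k, u k * v k ≠ 0 := fun k => by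
    by_cases h : k + 1 < n
    · rw [hu' k h, hv' k h]
      exact mul_ne_zero (hirr.ne_zero htri k h).1 (hirr.ne_zero htri k h).2
    · simp [hu, hv, h]
  obtain ⟨b, T, b', T', r, r', e⟩ := exists_isRealization_pair (n := n) hσ (by omega)
    (exists_isRealization_pair_of_alternating (σ := fun k => u k * v k) hσ (m := m)
      (by rw [huv m (by omega), huv (m + 1) (by omega), e1])
      (by rw [huv m (by omega), huv (m + 2) (by omega), e2]))
  have key : ∀ b T, IsRealization (fun k => u k * v k) n b T → n % 2 + 2 * numPos T = k := by
    intro b T r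
    rw [← numRealEigenvalues_of_isRealization r]
    exact hk _ (tridiagonalEntries_mem_qualClass htri hdiag hu' hv' fun k => by
      rw [← sign_ne_zero, r.sign_eq]
      exact hσ k)
  have := key b T r
  have := key b' T' r'
  omega
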